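/- Let $G$ be a finitely generated group, let $H$ be a finitely generated subgroup of $G$, and for a subset $U$ of $G$ write $U^{*}=G-U$. For a subgroup $L$ of $G$, let $L\backslash G$ be the set of cosets $Lg$, on which $G$ acts on the right. A subset $U$ of $G$ is called $L$-almost invariant if $hU=U$ for all $h\in L$ and the image $P$ of $U$ in $L\backslash G$ satisfies that the symmetric difference of $Pg$ and $P$ is finite for every $g\in G$; it is non-trivial if moreover the images of $U$ and $U^{*}$ in $L\backslash G$ are both infinite. If $U$ is $L$-almost invariant and $V$ is $M$-almost invariant, for subgroups $L$ and $M$ of $G$, then $U$ and $V$ are called equivalent, written $U\sim V$, if their symmetric difference is contained in the union of finitely many cosets $Lg$. Sets $U,V\subseteq G$ are nested if one of the four sets $U\cap V$, $U^{*}\cap V$, $U\cap V^{*}$, $U^{*}\cap V^{*}$ is empty. Let $X$ be a non-trivial $H$-almost invariant subset of $G$. Then $\mathcal{K}=\{g\in G : gX\sim X \text{ or } gX\sim X^{*}\}$, where $gX$ is regarded as a $gHg^{-1}$-almost invariant set, is a subgroup of $G$, and there are a subgroup $H'$ of $G$ commensurable with $H$ and a non-trivial $H'$-almost invariant set $Y$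 equivalent to $X$ such that $\{gY,gY^{*} : g\in G\}$ is nested with respect to $\mathcal{K}$, that is, $gY$ and $Y$ are nested for every $g\in\mathcal{K}$. -/

import Mathlib

open scoped Pointwise

namespace AlmostInvariantSets

variable {G : Type*} [Group G]

/-- The set `H\G` of cosets `Hg` of `H` in `G`. -/
abbrev CosetSpace (H : Subgroup G) : Type _ := Quotient (QuotientGroup.rightRel H)

/-- The projection `G → H\G`, sending `g` to `Hg`. -/
def proj (H : Subgroup G) (g : G) : CosetSpace H := Quotient.mk (QuotientGroup.rightRel H) g

/-- The right action of `g` on `H\G`, sending `Hx` to `Hxg`. -/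
def rightMul (H : Subgroup G) (g : G) : CosetSpace H → CosetSpace H :=
  Quotient.map (fun x => x * g) (by
    intro a b hab
    have hab' : b * a⁻¹ ∈ H := QuotientGroup.rightRel_apply.mp hab
    refine QuotientGroup.rightRel_apply.mpr ?_
    simpa [mul_assoc] using hab')

/-- Two sets are almost equal if their symmetric difference is finite. -/
def AlmostEqual {Z : Type*} (P Q : Set Z) : Prop := (symmDiff P Q).Finite

/-- A subset `P` of `H\G` is almost invariant if `Pg` is almost equal to `P` for all `g` in `G`. -/
def AlmostInvariant (H : Subgroup G) (P : Set (CosetSpace H)) : Prop :=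
  ∀ g : G, AlmostEqual (rightMul H g '' P) P

/-- `X ⊆ G` is `H`-almost invariant: `X` is invariant under left multiplication by `H`, and
its image `H\X` is an almost invariant subset of `H\G`. -/
def IsAlmostInvariant (H : Subgroup G) (X : Set G) : Prop :=
  (∀ h ∈ H, h • X = X) ∧ AlmostInvariant H (proj H '' X)

/-- `X` is a non-trivial `H`-almost invariant set: moreover `H\X` and `H\X*` are infinite. -/
def IsNontrivialAlmostInvariant (H : Subgroup G) (X : Set G) : Prop :=
  IsAlmostInvariant H X ∧ (proj H '' X).Infinite ∧ (proj H '' Xᶜ).Infinite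

/-- `W ⊆ G` is `H`-finite: it is contained in a union of finitely many cosets `Hg`. -/
def IsFiniteMod (H : Subgroup G) (W : Set G) : Prop :=
  ∃ F : Set G, F.Finite ∧ W ⊆ (H : Set G) * F

/-- `V` and `W` are `H`-almost equal: their symmetric difference is `H`-finite. -/
def AlmostEqualMod (H : Subgroup G) (V W : Set G) : Prop := IsFiniteMod H (symmDiff V W)

/-- `X ∼ Y` for an `H`-almost invariant set `X` and a `K`-almost invariant set `Y`:
the sets `X` and `Y` are `H`-almost equal. -/
def Equivalent (H K : Subgroup G) (X Y : Set G) : Prop :=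
  IsAlmostInvariant H X ∧ IsAlmostInvariant K Y ∧ AlmostEqualMod H X Y

/-- The conjugate `H^g = gHg⁻¹`. -/
def conj (g : G) (H : Subgroup G) : Subgroup G := H.map (MulAut.conj g).toMonoidHom

/-- `U` and `V` are nested: one of the four sets `U^(*) ∩ V^(*)` is empty. -/
def NestedPair (U V : Set G) : Prop :=
  U ∩ V = ∅ ∨ Uᶜ ∩ V = ∅ ∨ U ∩ Vᶜ = ∅ ∨ Uᶜ ∩ Vᶜ = ∅

/-- The collection `{gY, gY* : g ∈ G}` is nested with respect to the subgroup `𝒦` of `G`: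
`gY` and `Y` are nested whenever `g ∈ 𝒦`. -/
def TranslatesNestedWrt (𝒦 : Subgroup G) (Y : Set G) : Prop :=
  ∀ g ∈ 𝒦, NestedPair (g • Y) Y

end AlmostInvariantSets

/-!
Let `𝒦` be the set of `g` with `gX ∼ X` or `gX ∼ Xᶜ`. Such a `g` commensurates `H`
(`preservesFiniteMod_of_almostEqualMod`), so `𝒦` may be described by `H`-finiteness alone and is
visibly a subgroup, the `classStabilizer`.

Let `𝓕` be the family of those translates `gX`, `gXᶜ` with `g ∈ 𝒦` that are `H`-almost equal to
`X`. Two points of `G` are separated by finitely many members of `𝓕`, so the signed count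
`separation 𝓕 x y` of the members containing `x` but not `y` is an integer cocycle on `G`. Each
`g ∈ 𝒦` permutes `𝓕`, through `W ↦ gW` or `W ↦ (gW)ᶜ`, and so preserves the cocycle up to sign.
Fix a point `y`. The set `Y = {x | 0 < separation 𝓕 x y}` is a superlevel set of an integer valued
function, and every translate `gY` with `g ∈ 𝒦` is a superlevel or a sublevel set of the same
function; any two such sets are nested (`IsAlmostInvariant.translatesNestedWrt`).

It remains to choose `y` such that `Y ∼ X`. As `G` and `H` are finitely generated, the coboundary of
`X` lies in a connected `H`-finite subset `B` of a Cayley graph of `G`. If `B` and `gB` are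
disjoint then `gX` and `X` are nested, and as elements of `𝒦` commensurate `H` this covers all but
finitely many members of `𝓕`. A member `W` of `𝓕` nested with `X` satisfies `W ⊆ X` or `X ⊆ W`,
so it contains `x ∈ X` whenever it contains `y ∉ X`; the finitely many others have the same
property off an `H`-finite set `N`. Hence `separation 𝓕 x y ≥ 1` for `x ∈ X` and `y ∉ X` off `N`,
and taking for `y` a highest point of `Xᶜ` off `N` makes `Y` and `X` agree off `N`. The same
maximality shows that `H` fixes the level of `y`, so `Y` is `H`-invariant and `H' = H` will do.
-/

namespace AlmostInvariantSets

variable {G : Type*} [Group G] {H : Subgroup G} {X Y Z V W A B : Set G}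

/-! ### `H`-finite sets -/

theorem proj_eq_iff {a b : G} : proj H a = proj H b ↔ b * a⁻¹ ∈ H := by
  unfold proj
  rw [Quotient.eq]
  exact QuotientGroup.rightRel_apply

theorem isFiniteMod_iff_finite_image : IsFiniteMod H W ↔ (proj H '' W).Finite := by
  constructor
  · rintro ⟨F, hF, hW⟩
    refine (hF.image (proj H)).subset ?_
    rintro _ ⟨w, hw, rfl⟩
    obtain ⟨h, hh, f, hf, rfl⟩ := Set.mem_mul.1 (hW hw)
    exact ⟨f, hf, proj_eq_iff.2 (by simpa using hh)⟩
  · intro hW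
    refine ⟨Quotient.out '' (proj H '' W), hW.image _, fun w hw => ?_⟩
    refine Set.mem_mul.2 ⟨w * (proj H w).out⁻¹, ?_, (proj H w).out,
      ⟨_, ⟨w, hw, rfl⟩, rfl⟩, by group⟩
    exact proj_eq_iff.1 (Quotient.out_eq (proj H w))

theorem IsFiniteMod.mono (hW : IsFiniteMod H W) (h : V ⊆ W) : IsFiniteMod H V :=
  let ⟨F, hF, hWF⟩ := hW
  ⟨F, hF, h.trans hWF⟩

theorem isFiniteMod_empty : IsFiniteMod H (∅ : Set G) :=
  ⟨∅, Set.finite_empty, Set.empty_subset _⟩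

theorem IsFiniteMod.union (hV : IsFiniteMod H V) (hW : IsFiniteMod H W) :
    IsFiniteMod H (V ∪ W) := by
  rw [isFiniteMod_iff_finite_image] at *
  rw [Set.image_union]
  exact hV.union hW

theorem IsFiniteMod.biUnion {ι : Type*} {s : Set ι} (hs : s.Finite) {f : ι → Set G}
    (hf : ∀ i ∈ s, IsFiniteMod H (f i)) : IsFiniteMod H (⋃ i ∈ s, f i) := by
  rw [isFiniteMod_iff_finite_image, Set.image_iUnion₂]
  exact hs.biUnion fun i hi => isFiniteMod_iff_finite_image.1 (hf i hi)

theorem IsFiniteMod.mul_finite {F : Set G} (hW : IsFiniteMod H W) (hF : F.Finite) :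
    IsFiniteMod H (W * F) := by
  obtain ⟨E, hE, hWE⟩ := hW
  exact ⟨E * F, hE.mul hF, by rw [← mul_assoc]; exact Set.mul_subset_mul_right hWE⟩

theorem IsFiniteMod.preimage_mul_right (hW : IsFiniteMod H W) (u : G) :
    IsFiniteMod H {x | x * u ∈ W} :=
  (hW.mul_finite (Set.finite_singleton u⁻¹)).mono fun x hx =>
    Set.mem_mul.2 ⟨x * u, hx, u⁻¹, rfl, by group⟩

theorem IsFiniteMod.subgroup_mul (hW : IsFiniteMod H W) : IsFiniteMod H ((H : Set G) * W) := by
  obtain ⟨F, hF, hWF⟩ := hW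
  refine ⟨F, hF, (Set.mul_subset_mul_left hWF).trans ?_⟩
  rw [← mul_assoc, coe_mul_coe]

theorem isFiniteMod_conj {g : G} : IsFiniteMod (conj g H) W ↔ IsFiniteMod H (g⁻¹ • W) := by
  constructor
  · rintro ⟨F, hF, hWF⟩
    refine ⟨g⁻¹ • F, hF.smul_set, ?_⟩
    rintro _ ⟨w, hw, rfl⟩
    obtain ⟨_, ⟨h, hh, rfl⟩, f, hf, rfl⟩ := Set.mem_mul.1 (hWF hw)
    exact Set.mem_mul.2 ⟨h, hh, g⁻¹ * f, ⟨f, hf, rfl⟩, by simp [mul_assoc]⟩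
  · rintro ⟨F, hF, hWF⟩
    refine ⟨g • F, hF.smul_set, fun w hw => ?_⟩
    obtain ⟨h, hh, f, hf, hhf⟩ := Set.mem_mul.1 (hWF ⟨w, hw, rfl⟩)
    refine Set.mem_mul.2 ⟨g * h * g⁻¹, ⟨h, hh, by simp⟩, g * f, ⟨f, hf, rfl⟩, ?_⟩
    have : h * f = g⁻¹ * w := hhf
    calc g * h * g⁻¹ * (g * f) = g * (h * f) := by group
      _ = w := by rw [this]; group

theorem AlmostEqualMod.symm (h : AlmostEqualMod H V W) : AlmostEqualMod H W V := by
  unfold AlmostEqualMod at *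
  rwa [symmDiff_comm]

theorem AlmostEqualMod.trans (h : AlmostEqualMod H V W) (h' : AlmostEqualMod H W Z) :
    AlmostEqualMod H V Z :=
  (IsFiniteMod.union h h').mono (symmDiff_triangle V W Z)

theorem AlmostEqualMod.compl (h : AlmostEqualMod H V W) : AlmostEqualMod H Vᶜ Wᶜ := by
  unfold AlmostEqualMod at *
  rwa [compl_symmDiff_compl]

theorem AlmostEqualMod.refl : AlmostEqualMod H W W :=
  isFiniteMod_empty.mono (by simp)

theorem not_isFiniteMod_of_almostEqualMod (h : AlmostEqualMod H V W) (hW : ¬ IsFiniteMod H W) :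
    ¬ IsFiniteMod H V := fun hV =>
  hW <| (hV.union h).mono fun x hx => by
    by_cases hxV : x ∈ V
    · exact Or.inl hxV
    · exact Or.inr (Or.inr ⟨hx, hxV⟩)

/-! ### Almost invariant sets -/

/-- Almost invariance read in `G` rather than in `H\G`: for each `u`, the elements at which right
multiplication by `u` leaves `X` form an `H`-finite set. -/
theorem isAlmostInvariant_iff : IsAlmostInvariant H X ↔
    (∀ h ∈ H, h • X = X) ∧ ∀ u : G, IsFiniteMod H {x | x ∈ X ∧ x * u ∉ X} := by
  refine and_congr_right fun hX => ?_
  have key : ∀ a b : G, proj H a = proj H b → (a ∈ X ↔ b ∈ X) := fun a b hab => by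
    have h1 := proj_eq_iff.1 hab
    conv_rhs => rw [← hX _ h1, Set.mem_smul_set_iff_inv_smul_mem]
    simp
  have himage : ∀ u : G, symmDiff (rightMul H u '' (proj H '' X)) (proj H '' X) =
      proj H '' {x | x * u⁻¹ ∈ X ∧ x ∉ X} ∪ proj H '' {x | x ∈ X ∧ x * u⁻¹ ∉ X} := by
    intro u
    have h1 : rightMul H u '' (proj H '' X) = proj H '' {x | x * u⁻¹ ∈ X} := by
      ext q
      constructor
      · rintro ⟨_, ⟨x, hx, rfl⟩, rfl⟩
        exact ⟨x * u, by simpa using hx, rfl⟩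
      · rintro ⟨x, hx, rfl⟩
        refine ⟨_, ⟨x * u⁻¹, hx, rfl⟩, ?_⟩
        change proj H (x * u⁻¹ * u) = _
        simp
    have key' : ∀ a b : G, proj H a = proj H b → (a * u⁻¹ ∈ X ↔ b * u⁻¹ ∈ X) :=
      fun a b hab => key _ _ (proj_eq_iff.2 (by simpa [mul_assoc] using proj_eq_iff.1 hab))
    rw [h1, Set.symmDiff_def]
    congr 1
    · ext q
      constructor
      · rintro ⟨⟨x, hx, rfl⟩, hq⟩
        exact ⟨x, ⟨hx, fun h => hq ⟨x, h, rfl⟩⟩, rfl⟩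
      · rintro ⟨x, ⟨hx, hx'⟩, rfl⟩
        exact ⟨⟨x, hx, rfl⟩, fun ⟨y, hy, hyx⟩ => hx' ((key _ _ hyx).1 hy)⟩
    · ext q
      constructor
      · rintro ⟨⟨x, hx, rfl⟩, hq⟩
        exact ⟨x, ⟨hx, fun h => hq ⟨x, h, rfl⟩⟩, rfl⟩
      · rintro ⟨x, ⟨hx, hx'⟩, rfl⟩
        exact ⟨⟨x, hx, rfl⟩, fun ⟨y, hy, hyx⟩ => hx' ((key' _ _ hyx).1 hy)⟩
  unfold AlmostInvariant AlmostEqual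
  simp only [himage, Set.finite_union, ← isFiniteMod_iff_finite_image]
  constructor
  · intro h u
    simpa using (h u⁻¹).2
  · intro h u
    refine ⟨?_, h u⁻¹⟩
    simpa using (h u).preimage_mul_right u⁻¹

theorem isNontrivialAlmostInvariant_iff : IsNontrivialAlmostInvariant H X ↔
    IsAlmostInvariant H X ∧ ¬ IsFiniteMod H X ∧ ¬ IsFiniteMod H Xᶜ := by
  simp only [IsNontrivialAlmostInvariant, isFiniteMod_iff_finite_image, Set.Infinite]

theorem IsAlmostInvariant.mul_mem_iff (hX : IsAlmostInvariant H X) {h : G} (hh : h ∈ H) (x : G) :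
    h * x ∈ X ↔ x ∈ X := by
  conv_lhs => rw [← hX.1 h hh, Set.mem_smul_set_iff_inv_smul_mem]
  simp

theorem IsAlmostInvariant.compl (hX : IsAlmostInvariant H X) : IsAlmostInvariant H Xᶜ := by
  rw [isAlmostInvariant_iff] at *
  refine ⟨fun h hh => by rw [Set.smul_set_compl, hX.1 h hh], fun u => ?_⟩
  refine ((hX.2 u⁻¹).preimage_mul_right u).mono ?_
  rintro x ⟨hx, hxu⟩
  exact ⟨by simpa using hxu, by simpa using hx⟩

theorem IsNontrivialAlmostInvariant.compl (hX : IsNontrivialAlmostInvariant H X) :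
    IsNontrivialAlmostInvariant H Xᶜ :=
  ⟨hX.1.compl, hX.2.2, by simpa using hX.2.1⟩

theorem IsAlmostInvariant.smul (hX : IsAlmostInvariant H X) (g : G) :
    IsAlmostInvariant (conj g H) (g • X) := by
  have hX' := isAlmostInvariant_iff.1 hX
  refine isAlmostInvariant_iff.2 ⟨?_, fun u => isFiniteMod_conj.2 ((hX'.2 u).mono ?_)⟩
  · rintro _ ⟨h, hh, rfl⟩
    simp [smul_smul, mul_assoc]
    rw [mul_smul, hX.1 h hh]
  · rintro _ ⟨x, ⟨hx, hxu⟩, rfl⟩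
    rw [Set.mem_smul_set_iff_inv_smul_mem] at hx hxu
    exact ⟨hx, by simpa [mul_assoc] using hxu⟩

/-- An `H`-invariant set which is `H`-almost equal to an `H`-almost invariant set is itself
`H`-almost invariant. -/
theorem IsAlmostInvariant.of_almostEqualMod (hX : IsAlmostInvariant H X)
    (hY : ∀ h ∈ H, h • Y = Y) (hYX : AlmostEqualMod H Y X) : IsAlmostInvariant H Y := by
  have hX' := isAlmostInvariant_iff.1 hX
  refine isAlmostInvariant_iff.2 ⟨hY, fun u => ?_⟩
  refine (((hX'.2 u).union hYX).union (IsFiniteMod.preimage_mul_right hYX u)).mono ?_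
  rintro x ⟨hx, hxu⟩
  by_cases h1 : x ∈ X
  · by_cases h2 : x * u ∈ X
    · exact Or.inr (Or.inr ⟨h2, hxu⟩)
    · exact Or.inl (Or.inl ⟨h1, h2⟩)
  · exact Or.inl (Or.inr (Or.inl ⟨hx, h1⟩))

/-- An `H`-finite set of elements gives only finitely many translates of an `H`-invariant set
by their inverses. -/
theorem IsAlmostInvariant.finite_inv_smul (hX : IsAlmostInvariant H X) (hA : IsFiniteMod H A) :
    {W : Set G | ∃ a ∈ A, W = a⁻¹ • X}.Finite := by
  obtain ⟨F, hF, hAF⟩ := hA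
  refine (hF.image fun f => f⁻¹ • X).subset ?_
  rintro _ ⟨a, ha, rfl⟩
  obtain ⟨h, hh, f, hf, rfl⟩ := Set.mem_mul.1 (hAF ha)
  refine ⟨f, hf, ?_⟩
  simp only [mul_inv_rev, mul_smul]
  rw [hX.1 _ (H.inv_mem hh)]

/-! ### Elements preserving the class of `X` -/

/-- Left translation by `g` preserves `H`-finiteness. This holds for `g` and `g⁻¹` exactly when
`g` lies in the commensurator of `H`. -/
def PreservesFiniteMod (H : Subgroup G) (g : G) : Prop :=
  ∀ W : Set G, IsFiniteMod H W → IsFiniteMod H (g • W)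

theorem preservesFiniteMod_of_smul {g : G} (h : IsFiniteMod H (g • (H : Set G))) :
    PreservesFiniteMod H g := by
  rintro W ⟨F, hF, hWF⟩
  refine (h.mul_finite hF).mono ?_
  rw [smul_mul_assoc]
  exact Set.smul_set_mono hWF

theorem PreservesFiniteMod.mul {g k : G} (hg : PreservesFiniteMod H g)
    (hk : PreservesFiniteMod H k) : PreservesFiniteMod H (g * k) := fun W hW => by
  rw [mul_smul]
  exact hg _ (hk _ hW)

theorem PreservesFiniteMod.almostEqualMod {g : G} (hg : PreservesFiniteMod H g)
    (h : AlmostEqualMod H V W) : AlmostEqualMod H (g • V) (g • W) := by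
  unfold AlmostEqualMod at *
  rw [← Set.smul_set_symmDiff]
  exact hg _ h

/-- If a translate of `X` is `H`-almost equal to a non-trivial `H`-almost invariant set, the
translating element commensurates `H`: an `H`-orbit of long enough paths crosses from `Z` to `Zᶜ`,
hence crosses the coboundary of `k • X`, and conversely the coboundary of `k • X` is `H`-finite. -/
theorem preservesFiniteMod_of_almostEqualMod {k : G} (hX : IsNontrivialAlmostInvariant H X)
    (hZ : IsNontrivialAlmostInvariant H Z) (h : AlmostEqualMod H (k • X) Z) :
    PreservesFiniteMod H k ∧ PreservesFiniteMod H k⁻¹ := by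
  obtain ⟨hXa, hX1, hX2⟩ := isNontrivialAlmostInvariant_iff.1 hX
  obtain ⟨hZa, hZ1, hZ2⟩ := isNontrivialAlmostInvariant_iff.1 hZ
  have hXf := (isAlmostInvariant_iff.1 hXa).2
  have hZf := (isAlmostInvariant_iff.1 hZa).2
  have ne : ∀ {U N : Set G}, ¬ IsFiniteMod H U → IsFiniteMod H N → ∃ x ∈ U, x ∉ N := by
    intro U N hU hN
    by_contra! hc
    exact hU (hN.mono hc)
  constructor
  · obtain ⟨x, hx, -⟩ := ne hX1 isFiniteMod_empty
    obtain ⟨y, hy, -⟩ := ne hX2 isFiniteMod_empty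
    apply preservesFiniteMod_of_smul
    have hfin := ((hZf (x⁻¹ * y)).union h).union (IsFiniteMod.preimage_mul_right h (x⁻¹ * y))
    refine (hfin.preimage_mul_right x).mono ?_
    rintro _ ⟨t, ht, rfl⟩
    have h1 : k * t * x ∈ k • X := by
      rw [Set.mem_smul_set_iff_inv_smul_mem]
      simpa [mul_assoc] using (hXa.mul_mem_iff ht x).2 hx
    have h2 : k * t * x * (x⁻¹ * y) ∉ k • X := by
      rw [Set.mem_smul_set_iff_inv_smul_mem]
      simpa [mul_assoc] using fun hc => hy ((hXa.mul_mem_iff ht y).1 hc)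
    simp only [Set.mem_ofPred_eq, smul_eq_mul]
    by_cases h3 : k * t * x ∈ Z
    · by_cases h4 : k * t * x * (x⁻¹ * y) ∈ Z
      · exact Or.inr (Or.inr ⟨h4, h2⟩)
      · exact Or.inl (Or.inl ⟨h3, h4⟩)
    · exact Or.inl (Or.inr (Or.inl ⟨h1, h3⟩))
  · have hN := IsFiniteMod.subgroup_mul h
    have hsub : ∀ x : G, x ∉ (H : Set G) * symmDiff (k • X) Z → ∀ t ∈ H,
        (t * x ∈ k • X ↔ x ∈ Z) := by
      intro x hx t ht
      have : t * x ∉ symmDiff (k • X) Z := fun hc =>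
        hx (Set.mem_mul.2 ⟨t⁻¹, H.inv_mem ht, t * x, hc, by group⟩)
      rw [Set.mem_symmDiff] at this
      rw [← hZa.mul_mem_iff ht x]
      tauto
    obtain ⟨x, hx, hxN⟩ := ne hZ1 hN
    obtain ⟨y, hy, hyN⟩ := ne hZ2 hN
    apply preservesFiniteMod_of_smul
    refine ((hXf (x⁻¹ * y)).preimage_mul_right x).mono ?_
    rintro _ ⟨t, ht, rfl⟩
    have h1 := (hsub x hxN t ht).2 hx
    have h2 := mt (hsub y hyN t ht).1 hy
    rw [Set.mem_smul_set_iff_inv_smul_mem] at h1 h2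
    exact ⟨by simpa [mul_assoc] using h1, by simpa [mul_assoc] using h2⟩

theorem preservesFiniteMod_of_mem {h : G} (hh : h ∈ H) : PreservesFiniteMod H h := by
  apply preservesFiniteMod_of_smul
  refine ⟨{1}, Set.finite_singleton 1, ?_⟩
  rintro _ ⟨t, ht, rfl⟩
  exact Set.mem_mul.2 ⟨h * t, H.mul_mem hh ht, 1, rfl, by simp⟩

/-- The subgroup of the `g` in `G` such that `g • X` is `H`-almost equal to `X` or to `Xᶜ`, and
`g` commensurates `H`. -/
def classStabilizer (H : Subgroup G) (X : Set G) : Subgroup G where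
  carrier := {g | (PreservesFiniteMod H g ∧ PreservesFiniteMod H g⁻¹) ∧
    (AlmostEqualMod H (g • X) X ∨ AlmostEqualMod H (g • X) Xᶜ)}
  one_mem' := by
    refine ⟨⟨fun W hW => by simpa using hW, fun W hW => by simpa using hW⟩, Or.inl ?_⟩
    rw [one_smul]
    exact AlmostEqualMod.refl
  mul_mem' := by
    rintro g k ⟨⟨hg, hg'⟩, hgX⟩ ⟨⟨hk, hk'⟩, hkX⟩
    refine ⟨⟨hg.mul hk, by rw [mul_inv_rev]; exact hk'.mul hg'⟩, ?_⟩
    rw [mul_smul]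
    rcases hkX with hkX | hkX
    · have h1 := hg.almostEqualMod hkX
      exact hgX.imp h1.trans h1.trans
    · have h1 := hg.almostEqualMod hkX
      rw [Set.smul_set_compl] at h1
      refine hgX.symm.imp (fun h => h1.trans ?_) (fun h => h1.trans h.compl)
      simpa using h.compl
  inv_mem' := by
    rintro g ⟨⟨hg, hg'⟩, hgX⟩
    refine ⟨⟨hg', by simpa using hg⟩, ?_⟩
    refine hgX.imp (fun h => ?_) (fun h => ?_)
    · simpa using (hg'.almostEqualMod h).symm
    · have := (hg'.almostEqualMod h).symm.compl
      rw [Set.smul_set_compl] at this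
      simpa using this

theorem mem_classStabilizer {g : G} : g ∈ classStabilizer H X ↔
    (PreservesFiniteMod H g ∧ PreservesFiniteMod H g⁻¹) ∧
    (AlmostEqualMod H (g • X) X ∨ AlmostEqualMod H (g • X) Xᶜ) := Iff.rfl

theorem IsAlmostInvariant.le_classStabilizer (hX : IsAlmostInvariant H X) :
    H ≤ classStabilizer H X := fun h hh =>
  ⟨⟨preservesFiniteMod_of_mem hh, preservesFiniteMod_of_mem (H.inv_mem hh)⟩,
    Or.inl (by rw [hX.1 h hh]; exact AlmostEqualMod.refl)⟩

/-- `H^g`-almost equality of `g • X` and `Z` amounts to `H`-almost equality of `X` and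
`g⁻¹ • Z`. -/
theorem almostEqualMod_conj {g : G} :
    AlmostEqualMod (conj g H) (g • X) Z ↔ AlmostEqualMod H (g⁻¹ • Z) X := by
  unfold AlmostEqualMod
  rw [isFiniteMod_conj, Set.smul_set_symmDiff, inv_smul_smul, symmDiff_comm]

theorem coe_classStabilizer (hX : IsNontrivialAlmostInvariant H X) :
    (classStabilizer H X : Set G) = {g : G | Equivalent (conj g H) H (g • X) X ∨
      Equivalent (conj g H) H (g • X) Xᶜ} := by
  ext g
  simp only [SetLike.mem_coe, Set.mem_ofPred_eq, Equivalent, hX.1, hX.1.smul g, hX.1.compl,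
    true_and, almostEqualMod_conj]
  rw [← inv_mem_iff]
  have hcompl : AlmostEqualMod H (g⁻¹ • Xᶜ) X ↔ AlmostEqualMod H (g⁻¹ • X) Xᶜ := by
    rw [Set.smul_set_compl]
    exact ⟨fun h => by simpa using h.compl, fun h => by simpa using h.compl⟩
  rw [hcompl, mem_classStabilizer]
  refine ⟨fun h => h.2, fun h => ⟨?_, h⟩⟩
  rcases h with h | h
  · exact preservesFiniteMod_of_almostEqualMod hX hX h
  · exact preservesFiniteMod_of_almostEqualMod hX hX.compl h

/-! ### Counting separating sets -/

/-- The signed number of members of `𝓕` separating `x` from `y`: those containing `x` but not `y`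
count `1`, those containing `y` but not `x` count `-1`. It is meaningful for a family satisfying
`FinitelySeparating`. -/
noncomputable def separation {α : Type*} (𝓕 : Set (Set α)) (x y : α) : ℤ :=
  ∑ᶠ W : 𝓕, ((W : Set α).indicator 1 x - (W : Set α).indicator 1 y)

/-- Any two points are separated by only finitely many members of `𝓕`. -/
def FinitelySeparating {α : Type*} (𝓕 : Set (Set α)) : Prop :=
  ∀ x y : α, {W ∈ 𝓕 | x ∈ W ∧ y ∉ W}.Finite

variable {α : Type*} {𝓒 : Set (Set α)} {𝓕 : Set (Set G)}

theorem FinitelySeparating.finite_support (h𝓒 : FinitelySeparating 𝓒) (x y : α) :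
    (Function.support fun W : 𝓒 =>
      ((W : Set α).indicator 1 x - (W : Set α).indicator 1 y : ℤ)).Finite := by
  refine Set.Finite.subset (((h𝓒 x y).union (h𝓒 y x)).preimage
    Subtype.val_injective.injOn) ?_
  intro W hW
  by_cases h1 : x ∈ (W : Set α) <;> by_cases h2 : y ∈ (W : Set α) <;>
    simp_all

theorem FinitelySeparating.separation_add (h𝓒 : FinitelySeparating 𝓒) (x y z : α) :
    separation 𝓒 x y + separation 𝓒 y z = separation 𝓒 x z := by
  unfold separation
  rw [← finsum_add_distrib (h𝓒.finite_support x y) (h𝓒.finite_support y z)]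
  exact finsum_congr fun W => by ring

theorem FinitelySeparating.separation_self (h𝓒 : FinitelySeparating 𝓒) (x : α) :
    separation 𝓒 x x = 0 := by
  have := h𝓒.separation_add x x x
  omega

theorem FinitelySeparating.one_le_separation (h𝓒 : FinitelySeparating 𝓒) {x y : α}
    (h : ∀ W ∈ 𝓒, y ∈ W → x ∈ W) {U : Set α} (hU : U ∈ 𝓒) (hx : x ∈ U) (hy : y ∉ U) :
    1 ≤ separation 𝓒 x y := by
  classical
  refine le_trans ?_ (single_le_finsum (⟨U, hU⟩ : 𝓒) (h𝓒.finite_support x y) fun V => ?_)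
  · simp [hx, hy]
  · have := h V V.2
    by_cases h1 : x ∈ (V : Set α) <;> by_cases h2 : y ∈ (V : Set α) <;> simp_all

theorem separation_smul {g : G} (h : ∀ W ∈ 𝓕, g • W ∈ 𝓕) (h' : ∀ W ∈ 𝓕, g⁻¹ • W ∈ 𝓕) (x y : G) :
    separation 𝓕 (g * x) (g * y) = separation 𝓕 x y := by
  refine (finsum_eq_of_bijective (fun W : 𝓕 => (⟨g • (W : Set G), h _ W.2⟩ : 𝓕)) ?_ ?_).symm
  · refine Function.bijective_iff_has_inverse.2
      ⟨fun W => ⟨g⁻¹ • (W : Set G), h' _ W.2⟩, fun W => ?_, fun W => ?_⟩ <;> simp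
  · intro W
    classical
    simp [Set.indicator_apply, Set.mem_smul_set_iff_inv_smul_mem]

theorem separation_smul_compl {g : G} (h : ∀ W ∈ 𝓕, (g • W)ᶜ ∈ 𝓕)
    (h' : ∀ W ∈ 𝓕, (g⁻¹ • W)ᶜ ∈ 𝓕) (x y : G) :
    separation 𝓕 (g * x) (g * y) = separation 𝓕 y x := by
  refine (finsum_eq_of_bijective (fun W : 𝓕 => (⟨(g • (W : Set G))ᶜ, h _ W.2⟩ : 𝓕)) ?_ ?_).symm
  · refine Function.bijective_iff_has_inverse.2
      ⟨fun W => ⟨(g⁻¹ • (W : Set G))ᶜ, h' _ W.2⟩, fun W => ?_, fun W => ?_⟩ <;>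
    simp [Set.smul_set_compl]
  · intro W
    classical
    by_cases h1 : x ∈ (W : Set G) <;> by_cases h2 : y ∈ (W : Set G) <;>
      simp [Set.mem_smul_set_iff_inv_smul_mem, h1, h2]

/-- The translates of `X` and of `Xᶜ` by the stabilizer of the class of `X` that are `H`-almost
equal to `X`. -/
def equivalentTranslates (H : Subgroup G) (X : Set G) : Set (Set G) :=
  {W | (∃ g ∈ classStabilizer H X, W = g • X ∨ W = (g • X)ᶜ) ∧ AlmostEqualMod H W X}

theorem self_mem_equivalentTranslates : X ∈ equivalentTranslates H X :=
  ⟨⟨1, one_mem _, Or.inl (by simp)⟩, AlmostEqualMod.refl⟩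

theorem smul_mem_equivalentTranslates {g : G} (hg : g ∈ classStabilizer H X)
    (hgX : AlmostEqualMod H (g • X) X) (hW : W ∈ equivalentTranslates H X) :
    g • W ∈ equivalentTranslates H X := by
  obtain ⟨⟨k, hk, hWk⟩, hWX⟩ := hW
  refine ⟨⟨g * k, mul_mem hg hk, hWk.imp ?_ ?_⟩, (hg.1.1.almostEqualMod hWX).trans hgX⟩
  · rintro rfl
    rw [mul_smul]
  · rintro rfl
    rw [mul_smul, Set.smul_set_compl]

theorem smul_compl_mem_equivalentTranslates {g : G} (hg : g ∈ classStabilizer H X)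
    (hgX : AlmostEqualMod H (g • X) Xᶜ) (hW : W ∈ equivalentTranslates H X) :
    (g • W)ᶜ ∈ equivalentTranslates H X := by
  obtain ⟨⟨k, hk, hWk⟩, hWX⟩ := hW
  refine ⟨⟨g * k, mul_mem hg hk, hWk.symm.imp ?_ ?_⟩,
    by simpa using ((hg.1.1.almostEqualMod hWX).trans hgX).compl⟩
  · rintro rfl
    rw [mul_smul, Set.smul_set_compl, compl_compl]
  · rintro rfl
    rw [mul_smul]

theorem almostEqualMod_inv_smul {g : G} (hg : g ∈ classStabilizer H X)
    (hgX : AlmostEqualMod H (g • X) X) : AlmostEqualMod H (g⁻¹ • X) X := by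
  simpa using (hg.1.2.almostEqualMod hgX).symm

theorem almostEqualMod_inv_smul_compl {g : G} (hg : g ∈ classStabilizer H X)
    (hgX : AlmostEqualMod H (g • X) Xᶜ) : AlmostEqualMod H (g⁻¹ • X) Xᶜ := by
  have := (hg.1.2.almostEqualMod hgX).symm.compl
  rw [Set.smul_set_compl] at this
  simpa using this

theorem IsAlmostInvariant.finitelySeparating (hX : IsAlmostInvariant H X) :
    FinitelySeparating (equivalentTranslates H X) := by
  intro x y
  have hX' := (isAlmostInvariant_iff.1 hX).2
  have hX'' := (isAlmostInvariant_iff.1 hX.compl).2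
  have h1 := hX.finite_inv_smul (((hX' (x⁻¹ * y)).preimage_mul_right x).union
    ((hX'' (x⁻¹ * y)).preimage_mul_right x))
  refine (h1.union (h1.image (fun V : Set G => Vᶜ))).subset ?_
  rintro W ⟨⟨⟨g, -, rfl | rfl⟩, -⟩, hx, hy⟩
  · refine Or.inl ⟨g⁻¹, Or.inl ?_, by simp⟩
    rw [Set.mem_smul_set_iff_inv_smul_mem] at hx hy
    exact ⟨hx, by simpa [mul_assoc] using hy⟩
  · refine Or.inr ⟨g • X, ⟨g⁻¹, Or.inr ?_, by simp⟩, rfl⟩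
    rw [Set.mem_compl_iff, Set.mem_smul_set_iff_inv_smul_mem] at hx hy
    exact ⟨hx, by simpa [mul_assoc] using hy⟩

/-! ### Disjoint translates of a connected neighbourhood -/

/-- `B` is connected in the graph on `G` with edges `x — x * s` for `s ∈ S`, phrased by saying that
a set separating no edge inside `B` does not separate `B`. -/
def ConnectedIn (S B : Set G) : Prop :=
  ∀ W : Set G, (∀ x ∈ B, ∀ s ∈ S, x * s ∈ B → (x ∈ W ↔ x * s ∈ W)) → B ⊆ W ∨ B ⊆ Wᶜ

/-- The one place where the finite generation of `G` and of `H` enters: `H` has connected `H`-finite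
neighbourhoods in a Cayley graph, of arbitrarily large size. -/
theorem exists_connectedIn [Group.FG G] (hH : H.FG) :
    ∃ S : Set G, S.Finite ∧ (∀ s ∈ S, s⁻¹ ∈ S) ∧ Subgroup.closure S = ⊤ ∧
      ∀ F : Set G, F.Finite → ∃ F' : Set G, F'.Finite ∧ F ⊆ F' ∧
        ConnectedIn S ((H : Set G) * F') := by
  obtain ⟨T, hT⟩ := hH
  obtain ⟨S₀, hS₀⟩ := (Group.FG.out : (⊤ : Subgroup G).FG)
  set R : Set G := insert 1 (S₀ ∪ T) with hR
  have hRfin : R.Finite := (S₀.finite_toSet.union T.finite_toSet).insert 1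
  set S : Set G := R ∪ R⁻¹ with hS
  have hSfin : S.Finite := hRfin.union hRfin.inv
  have hSinv : ∀ s ∈ S, s⁻¹ ∈ S := fun s hs => hs.symm.imp id fun h => by simpa using h
  have h1S : (1 : G) ∈ S := Or.inl (Set.mem_insert _ _)
  have hTS : (T : Set G) ⊆ S := fun t ht => Or.inl (Or.inr (Or.inr ht))
  have hcl : Subgroup.closure S = ⊤ := by
    rw [eq_top_iff, ← hS₀]
    exact Subgroup.closure_mono fun t ht => Or.inl (Or.inr (Or.inl ht))
  have hpow : ∀ x : G, ∃ n : ℕ, x ∈ S ^ n := by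
    intro x
    have hx : x ∈ Subgroup.closure S := hcl ▸ Subgroup.mem_top x
    induction hx using Subgroup.closure_induction_right with
    | one => exact ⟨0, by simp⟩
    | mul_right x hx y hy ih =>
      obtain ⟨n, hn⟩ := ih
      exact ⟨n + 1, by rw [pow_succ]; exact Set.mul_mem_mul hn hy⟩
    | mul_inv_cancel x hx y hy ih =>
      obtain ⟨n, hn⟩ := ih
      exact ⟨n + 1, by rw [pow_succ]; exact Set.mul_mem_mul hn (hSinv y hy)⟩
  have hpowfin : ∀ n : ℕ, (S ^ n).Finite := by
    intro n
    induction n with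
    | zero => simp
    | succ n ih => rw [pow_succ]; exact ih.mul hSfin
  refine ⟨S, hSfin, hSinv, hcl, fun F hF => ?_⟩
  choose n hn using hpow
  obtain ⟨N, hN⟩ := (hF.image n).bddAbove
  refine ⟨S ^ N, hpowfin N, fun x hx => ?_, fun W hW => ?_⟩
  · exact Set.pow_subset_pow_right h1S (hN ⟨x, hx, rfl⟩) (hn x)
  · have hmem : ∀ h ∈ H, ∀ m ≤ N, ∀ x ∈ S ^ m, h * x ∈ (H : Set G) * S ^ N :=
      fun h hh m hm x hx => Set.mul_mem_mul hh (Set.pow_subset_pow_right h1S hm hx)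
    have hmem1 : ∀ h ∈ H, h ∈ (H : Set G) * S ^ N := fun h hh => by
      simpa using hmem h hh 0 (Nat.zero_le _) 1 (by simp)
    -- Inside `H`, moving along generators of `H` connects every element to `1`.
    have hHW : ∀ h ∈ H, (h ∈ W ↔ 1 ∈ W) := by
      intro h hh
      rw [← hT] at hh
      induction hh using Subgroup.closure_induction_right with
      | one => rfl
      | mul_right x hx y hy ih =>
        rw [hT] at hx
        have hyH : y ∈ H := hT ▸ Subgroup.subset_closure hy
        rw [← ih]
        exact (hW x (hmem1 x hx) y (hTS hy) (hmem1 _ (mul_mem hx hyH))).symm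
      | mul_inv_cancel x hx y hy ih =>
        rw [hT] at hx
        have hyH : y ∈ H := hT ▸ Subgroup.subset_closure hy
        rw [← ih]
        exact (hW x (hmem1 x hx) y⁻¹ (hSinv _ (hTS hy))
          (hmem1 _ (mul_mem hx (inv_mem hyH)))).symm
    have hball : ∀ m ≤ N, ∀ h ∈ H, ∀ x ∈ S ^ m, (h * x ∈ W ↔ 1 ∈ W) := by
      intro m
      induction m with
      | zero =>
        intro _ h hh x hx
        obtain rfl : x = 1 := by simpa using hx
        simpa using hHW h hh
      | succ m ih =>
        intro hm h hh x hx
        rw [pow_succ] at hx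
        obtain ⟨y, hy, s, hs, rfl⟩ := Set.mem_mul.1 hx
        rw [← ih (by omega) h hh y hy, ← mul_assoc]
        refine (hW (h * y) (hmem h hh m (by omega) y hy) s hs ?_).symm
        rw [mul_assoc]
        exact hmem h hh (m + 1) hm _ (by rw [pow_succ]; exact hx)
    by_cases h1 : (1 : G) ∈ W
    · left
      intro z hz
      obtain ⟨h, hh, x, hx, rfl⟩ := Set.mem_mul.1 hz
      exact (hball N le_rfl h hh x hx).2 h1
    · right
      intro z hz
      obtain ⟨h, hh, x, hx, rfl⟩ := Set.mem_mul.1 hz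
      exact fun hc => h1 ((hball N le_rfl h hh x hx).1 hc)

/-- If no edge of the Cayley graph leaving one of `A` and `W` starts in the other, then no edge leaves
`A ∩ W`, so by connectedness the intersection is empty or everything. -/
theorem inter_eq_empty_or_univ {S : Set G} (hSinv : ∀ s ∈ S, s⁻¹ ∈ S)
    (hS : Subgroup.closure S = ⊤)
    (h1 : ∀ x ∈ A, ∀ s ∈ S, x * s ∉ A → x ∉ W) (h2 : ∀ x ∈ W, ∀ s ∈ S, x * s ∉ W → x ∉ A) :
    A ∩ W = ∅ ∨ A ∩ W = Set.univ := by
  have hstep : ∀ x ∈ A ∩ W, ∀ s ∈ S, x * s ∈ A ∩ W := fun x hx s hs =>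
    ⟨by_contra fun h => h1 x hx.1 s hs h hx.2, by_contra fun h => h2 x hx.2 s hs h hx.1⟩
  rcases Set.eq_empty_or_nonempty (A ∩ W) with h | ⟨x, hx⟩
  · exact Or.inl h
  · right
    have hall : ∀ z : G, x * z ∈ A ∩ W := by
      intro z
      have hz : z ∈ Subgroup.closure S := hS ▸ Subgroup.mem_top z
      induction hz using Subgroup.closure_induction_right with
      | one => simpa using hx
      | mul_right y _ s hs ih => rw [← mul_assoc]; exact hstep _ ih s hs
      | mul_inv_cancel y _ s hs ih => rw [← mul_assoc]; exact hstep _ ih _ (hSinv s hs)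
    exact Set.eq_univ_of_forall fun z => by simpa using hall (x⁻¹ * z)

/-- If a connected set `B` contains the coboundary of `X`, and `B` is disjoint from `g • B`, then
`g • X` and `X` are nested. -/
theorem nestedPair_of_disjoint {S : Set G} (hSinv : ∀ s ∈ S, s⁻¹ ∈ S)
    (hS : Subgroup.closure S = ⊤) (hB : ConnectedIn S B)
    (hXB : ∀ x, ∀ s ∈ S, ¬ (x ∈ X ↔ x * s ∈ X) → x ∈ B)
    (hX : X ≠ Set.univ) (hX' : Xᶜ ≠ Set.univ) {g : G} (hg : Disjoint B (g • B)) :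
    NestedPair (g • X) X := by
  have hgB : ∀ x, ∀ s ∈ S, ¬ (x ∈ g • X ↔ x * s ∈ g • X) → x ∈ g • B := by
    intro x s hs h
    rw [Set.mem_smul_set_iff_inv_smul_mem, Set.mem_smul_set_iff_inv_smul_mem] at h
    rw [Set.mem_smul_set_iff_inv_smul_mem]
    exact hXB _ s hs (by simpa [mul_assoc] using h)
  have hB1 : B ⊆ g • X ∨ B ⊆ (g • X)ᶜ := hB _ fun x hx s hs _ => by
    by_contra h
    exact Set.disjoint_left.1 hg hx (hgB x s hs h)
  have hB2 : g • B ⊆ X ∨ g • B ⊆ Xᶜ := by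
    have := hB (g⁻¹ • X) fun x hx s hs _ => by
      by_contra h
      rw [Set.mem_inv_smul_set_iff, Set.mem_inv_smul_set_iff] at h
      exact Set.disjoint_left.1 hg (hXB (g * x) s hs (by simpa [mul_assoc] using h))
        ⟨x, hx, rfl⟩
    refine this.imp (fun h => ?_) (fun h => ?_)
    · rintro _ ⟨x, hx, rfl⟩
      exact Set.mem_inv_smul_set_iff.1 (h hx)
    · rintro _ ⟨x, hx, rfl⟩ hc
      exact h hx (Set.mem_inv_smul_set_iff.2 hc)
  have corner : ∀ A C : Set G, A ≠ Set.univ →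
      (∀ x, ∀ s ∈ S, x ∈ A → x * s ∉ A → x ∈ B) →
      (∀ x, ∀ s ∈ S, x ∈ C → x * s ∉ C → x ∈ g • B) →
      B ⊆ Cᶜ → g • B ⊆ Aᶜ → C ∩ A = ∅ := by
    intro A C hA h1 h2 h3 h4
    rw [Set.inter_comm]
    refine (inter_eq_empty_or_univ hSinv hS (fun x hx s hs h => h3 (h1 x s hs hx h))
      (fun x hx s hs h => h4 (h2 x s hs hx h))).resolve_right fun h => hA ?_
    exact Set.eq_univ_of_univ_subset (h ▸ Set.inter_subset_left)
  have e1 : ∀ x, ∀ s ∈ S, x ∈ X → x * s ∉ X → x ∈ B :=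
    fun x s hs h h' => hXB x s hs fun hc => h' (hc.1 h)
  have e2 : ∀ x, ∀ s ∈ S, x ∈ Xᶜ → x * s ∉ Xᶜ → x ∈ B :=
    fun x s hs h h' => hXB x s hs fun hc => h' fun hc' => h (hc.2 hc')
  have f1 : ∀ x, ∀ s ∈ S, x ∈ g • X → x * s ∉ g • X → x ∈ g • B :=
    fun x s hs h h' => hgB x s hs fun hc => h' (hc.1 h)
  have f2 : ∀ x, ∀ s ∈ S, x ∈ (g • X)ᶜ → x * s ∉ (g • X)ᶜ → x ∈ g • B :=
    fun x s hs h h' => hgB x s hs fun hc => h' fun hc' => h (hc.2 hc')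
  rcases hB1 with hB1 | hB1 <;> rcases hB2 with hB2 | hB2
  · exact Or.inr (Or.inr (Or.inr (corner _ _ hX' e2 f2 (by simpa using hB1) (by simpa using hB2))))
  · exact Or.inr (Or.inl (corner _ _ hX e1 f2 (by simpa using hB1) hB2))
  · exact Or.inr (Or.inr (Or.inl (corner _ _ hX' e2 f1 hB1 (by simpa using hB2))))
  · exact Or.inl (corner _ _ hX e1 f1 hB1 hB2)

/-- If `F` is finite, only finitely many sets `g • X` arise from those `g` in the stabilizer of the
class of `X` for which `g • (H * F)` meets `H * F`. Such a `g` lies in `H * f * H` for one of finitely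
many commensurating elements `f`, and `H * f * H` is then a finite union of cosets of `H`. -/
theorem IsAlmostInvariant.finite_smul_of_not_disjoint (hX : IsAlmostInvariant H X) {F : Set G}
    (hF : F.Finite) :
    {W : Set G | ∃ g ∈ classStabilizer H X,
      ¬ Disjoint ((H : Set G) * F) (g • ((H : Set G) * F)) ∧ W = g • X}.Finite := by
  have hA : IsFiniteMod H ((H : Set G) *
      ⋃ f ∈ (F * F⁻¹) ∩ (classStabilizer H X : Set G), f⁻¹ • (H : Set G)) := by
    refine (IsFiniteMod.biUnion ((hF.mul hF.inv).inter_of_left _) fun f hf => ?_).subgroup_mul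
    exact hf.2.1.2 _ ⟨{1}, Set.finite_singleton 1, by simp⟩
  refine (hX.finite_inv_smul hA).subset ?_
  rintro _ ⟨g, hg, hgF, rfl⟩
  refine ⟨g⁻¹, ?_, by simp⟩
  obtain ⟨b, hb, hb'⟩ := Set.not_disjoint_iff.1 hgF
  obtain ⟨h, hh, f, hf, rfl⟩ := Set.mem_mul.1 hb
  obtain ⟨_, hb'', hgb⟩ := hb'
  obtain ⟨h', hh', f', hf', rfl⟩ := Set.mem_mul.1 hb''
  have hgb' : g * (h' * f') = h * f := hgb
  have hg' : g = h * (f * f'⁻¹) * h'⁻¹ := by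
    rw [← mul_assoc h f, ← hgb']
    group
  have hff : f * f'⁻¹ ∈ classStabilizer H X := by
    have : f * f'⁻¹ = h⁻¹ * g * h' := by rw [hg']; group
    rw [this]
    exact mul_mem (mul_mem (inv_mem (hX.le_classStabilizer hh)) hg) (hX.le_classStabilizer hh')
  refine Set.mem_mul.2 ⟨h', hh', (f * f'⁻¹)⁻¹ * h⁻¹, ?_, by rw [hg']; group⟩
  exact Set.mem_biUnion (⟨Set.mul_mem_mul hf (Set.inv_mem_inv.2 hf'), hff⟩ :
    f * f'⁻¹ ∈ (F * F⁻¹) ∩ (classStabilizer H X : Set G)) ⟨h⁻¹, H.inv_mem hh, rfl⟩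

/-- All but finitely many of the translates equivalent to `X` are comparable with `X`. -/
theorem IsNontrivialAlmostInvariant.finite_not_comparable [Group.FG G] (hH : H.FG)
    (hX : IsNontrivialAlmostInvariant H X) :
    {W ∈ equivalentTranslates H X | ¬ (W ⊆ X ∨ X ⊆ W)}.Finite := by
  obtain ⟨S, hSfin, hSinv, hS, hconn⟩ := exists_connectedIn hH
  obtain ⟨hXa, hX1, hX2⟩ := isNontrivialAlmostInvariant_iff.1 hX
  obtain ⟨F, hF, hF'⟩ : IsFiniteMod H (⋃ s ∈ S, {x | x ∈ X ∧ x * s ∉ X} ∪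
      {x | x ∈ Xᶜ ∧ x * s ∉ Xᶜ}) :=
    IsFiniteMod.biUnion hSfin fun s _ => ((isAlmostInvariant_iff.1 hXa).2 s).union
      ((isAlmostInvariant_iff.1 hXa.compl).2 s)
  obtain ⟨F', hFfin, hFF', hB⟩ := hconn F hF
  have hXB : ∀ x, ∀ s ∈ S, ¬ (x ∈ X ↔ x * s ∈ X) → x ∈ (H : Set G) * F' := by
    intro x s hs h
    refine Set.mul_subset_mul_left hFF' (hF' (Set.mem_biUnion hs ?_))
    by_cases hx : x ∈ X
    · exact Or.inl ⟨hx, fun h' => h (by simp [hx, h'])⟩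
    · exact Or.inr ⟨hx, fun h' => h (by simpa [hx] using h')⟩
  have hfin := hXa.finite_smul_of_not_disjoint hFfin
  refine (hfin.union (hfin.image (fun V : Set G => Vᶜ))).subset ?_
  rintro W ⟨⟨⟨g, hg, hWg⟩, hWX⟩, hW⟩
  by_cases hd : Disjoint ((H : Set G) * F') (g • ((H : Set G) * F'))
  · have hn := nestedPair_of_disjoint hSinv hS hB hXB
      (fun h => hX2 (by rw [h]; simpa using isFiniteMod_empty)) (fun h => hX1 (by
        rw [← compl_compl X, h]; simpa using isFiniteMod_empty)) hd
    have hn' : NestedPair W X := by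
      rcases hWg with rfl | rfl
      · exact hn
      · unfold NestedPair at *
        rw [compl_compl]
        tauto
    exfalso
    rcases hn' with h | h | h | h
    · refine hX1 (IsFiniteMod.mono hWX fun x hx => Or.inr ⟨hx, fun hxW => ?_⟩)
      exact (h ▸ (⟨hxW, hx⟩ : x ∈ W ∩ X) : x ∈ (∅ : Set G))
    · exact hW (Or.inr fun x hx => by_contra fun hxW =>
        (h ▸ (⟨hxW, hx⟩ : x ∈ Wᶜ ∩ X) : x ∈ (∅ : Set G)))
    · exact hW (Or.inl fun x hx => by_contra fun hxX =>
        (h ▸ (⟨hx, hxX⟩ : x ∈ W ∩ Xᶜ) : x ∈ (∅ : Set G)))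
    · refine hX2 (IsFiniteMod.mono hWX fun x hx => Or.inl ⟨by_contra fun hxW => ?_, hx⟩)
      exact (h ▸ (⟨hxW, hx⟩ : x ∈ Wᶜ ∩ Xᶜ) : x ∈ (∅ : Set G))
  · rcases hWg with rfl | rfl
    · exact Or.inl ⟨g, hg, hd, rfl⟩
    · exact Or.inr ⟨g • X, ⟨g, hg, hd, rfl⟩, rfl⟩

/-! ### A superlevel set of the separation function -/

/-- Off an `H`-finite set, points of `X` lie strictly above points of `Xᶜ`. -/
theorem IsNontrivialAlmostInvariant.exists_one_le_separation [Group.FG G] (hH : H.FG)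
    (hX : IsNontrivialAlmostInvariant H X) :
    ∃ N : Set G, IsFiniteMod H N ∧ (∀ h ∈ H, ∀ x, x ∉ N → h * x ∉ N) ∧
      ∀ x ∈ X, x ∉ N → ∀ y ∉ X, y ∉ N → 1 ≤ separation (equivalentTranslates H X) x y := by
  have hfin : IsFiniteMod H (⋃ W ∈ {W ∈ equivalentTranslates H X | ¬ (W ⊆ X ∨ X ⊆ W)},
      symmDiff W X) :=
    IsFiniteMod.biUnion (hX.finite_not_comparable hH) fun W hW => hW.1.2
  refine ⟨_, hfin.subgroup_mul, fun h hh x hx hc => hx ?_, fun x hx hxN y hy hyN => ?_⟩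
  · obtain ⟨h', hh', z, hz, hhz⟩ := Set.mem_mul.1 hc
    refine Set.mem_mul.2 ⟨h⁻¹ * h', mul_mem (inv_mem hh) hh', z, hz, ?_⟩
    rw [mul_assoc, hhz]
    group
  · refine hX.1.finitelySeparating.one_le_separation (fun W hW hyW => ?_)
      self_mem_equivalentTranslates hx hy
    -- No member of the family separates `y` from `x` the wrong way round: `N` contains the points
    -- at which a member not comparable with `X` differs from `X`.
    by_cases hc : W ⊆ X ∨ X ⊆ W
    · rcases hc with hc | hc
      · exact absurd (hc hyW) hy
      · exact hc hx
    · refine absurd (Set.mem_mul.2 ⟨1, H.one_mem, y, ?_, one_mul y⟩) hyN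
      exact Set.mem_biUnion (⟨hW, hc⟩ :
        W ∈ {W ∈ equivalentTranslates H X | ¬ (W ⊆ X ∨ X ⊆ W)}) (Or.inl ⟨hyW, hy⟩)

/-- Elements of the stabilizer of the class of `X` carry the separation function to itself up to
sign, so they carry its superlevel sets to superlevel or sublevel sets. -/
theorem IsAlmostInvariant.translatesNestedWrt (hX : IsAlmostInvariant H X) (y : G) :
    TranslatesNestedWrt (classStabilizer H X)
      {x | 0 < separation (equivalentTranslates H X) x y} := by
  intro g hg
  have hadd := hX.finitelySeparating.separation_add
  have hmem : ∀ x, x ∈ g • {x | 0 < separation (equivalentTranslates H X) x y} ↔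
      0 < separation (equivalentTranslates H X) (g⁻¹ * x) y := fun x => by
    rw [Set.mem_smul_set_iff_inv_smul_mem]
    rfl
  rcases hg.2 with h | h
  · have hq : ∀ x, separation (equivalentTranslates H X) (g⁻¹ * x) y =
        separation (equivalentTranslates H X) x (g * y) := fun x => by
      rw [← separation_smul (fun W => smul_mem_equivalentTranslates hg h)
        (fun W => smul_mem_equivalentTranslates (inv_mem hg) (almostEqualMod_inv_smul hg h))]
      simp
    rcases le_total 0 (separation (equivalentTranslates H X) y (g * y)) with hc | hc
    · refine Or.inr (Or.inl (Set.eq_empty_of_forall_notMem ?_))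
      rintro x ⟨hx, hx'⟩
      rw [Set.mem_compl_iff, hmem, hq] at hx
      simp only [Set.mem_ofPred_eq] at hx'
      have := hadd x y (g * y)
      omega
    · refine Or.inr (Or.inr (Or.inl (Set.eq_empty_of_forall_notMem ?_)))
      rintro x ⟨hx, hx'⟩
      rw [hmem, hq] at hx
      simp only [Set.mem_compl_iff, Set.mem_ofPred_eq] at hx'
      have := hadd x y (g * y)
      omega
  · have hq : ∀ x, separation (equivalentTranslates H X) (g⁻¹ * x) y =
        separation (equivalentTranslates H X) (g * y) x := fun x => by
      rw [← separation_smul_compl (fun W => smul_compl_mem_equivalentTranslates hg h)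
        (fun W => smul_compl_mem_equivalentTranslates (inv_mem hg)
          (almostEqualMod_inv_smul_compl hg h))]
      simp
    -- For integer levels, `{q < c}` and `{0 < q}` are disjoint if `c ≤ 1` and cover `G` if `1 ≤ c`.
    rcases le_or_gt (separation (equivalentTranslates H X) (g * y) y) 1 with hc | hc
    · refine Or.inl (Set.eq_empty_of_forall_notMem ?_)
      rintro x ⟨hx, hx'⟩
      rw [hmem, hq] at hx
      simp only [Set.mem_ofPred_eq] at hx'
      have := hadd (g * y) x y
      omega
    · refine Or.inr (Or.inr (Or.inr (Set.eq_empty_of_forall_notMem ?_)))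
      rintro x ⟨hx, hx'⟩
      rw [Set.mem_compl_iff, hmem, hq] at hx
      simp only [Set.mem_compl_iff, Set.mem_ofPred_eq] at hx'
      have := hadd (g * y) x y
      omega

theorem IsNontrivialAlmostInvariant.exists_nested [Group.FG G] (hH : H.FG)
    (hX : IsNontrivialAlmostInvariant H X) :
    ∃ Y : Set G, IsNontrivialAlmostInvariant H Y ∧ AlmostEqualMod H Y X ∧
      TranslatesNestedWrt (classStabilizer H X) Y := by
  obtain ⟨N, hN, hHN, hsep⟩ := hX.exists_one_le_separation hH
  obtain ⟨hXa, hX1, hX2⟩ := isNontrivialAlmostInvariant_iff.1 hX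
  have hadd := hXa.finitelySeparating.separation_add
  have hself := hXa.finitelySeparating.separation_self
  obtain ⟨x₀, hx₀, hx₀N⟩ : ∃ x ∈ X, x ∉ N := by
    by_contra! hc
    exact hX1 (hN.mono hc)
  obtain ⟨y₁, hy₁, hy₁N⟩ : ∃ y ∈ Xᶜ, y ∉ N := by
    by_contra! hc
    exact hX2 (hN.mono hc)
  -- `x₀` bounds the points of `Xᶜ` off `N` from above; take the threshold at a highest one.
  obtain ⟨y, ⟨hy, hyN⟩, hmax⟩ : ∃ y, (y ∉ X ∧ y ∉ N) ∧ ∀ z, z ∉ X → z ∉ N →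
      separation (equivalentTranslates H X) z y ≤ 0 := by
    obtain ⟨m, ⟨y, hy, rfl⟩, hm⟩ := Int.exists_least_of_bdd
      (P := fun m => ∃ y, (y ∉ X ∧ y ∉ N) ∧ separation (equivalentTranslates H X) x₀ y = m)
      ⟨1, by rintro _ ⟨z, hz, rfl⟩; exact hsep x₀ hx₀ hx₀N z hz.1 hz.2⟩
      ⟨_, y₁, ⟨hy₁, hy₁N⟩, rfl⟩
    refine ⟨y, hy, fun z hz hzN => ?_⟩
    have h1 := hm _ ⟨z, ⟨hz, hzN⟩, rfl⟩
    have h2 := hadd x₀ z y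
    omega
  have hsmul : ∀ h ∈ H, ∀ a b, separation (equivalentTranslates H X) (h * a) (h * b) =
      separation (equivalentTranslates H X) a b := fun h hh =>
    separation_smul
      (fun W => smul_mem_equivalentTranslates (hXa.le_classStabilizer hh)
        (by rw [hXa.1 h hh]; exact AlmostEqualMod.refl))
      (fun W => smul_mem_equivalentTranslates (inv_mem (hXa.le_classStabilizer hh))
        (by rw [hXa.1 _ (inv_mem hh)]; exact AlmostEqualMod.refl))
  have hle : ∀ h ∈ H, separation (equivalentTranslates H X) (h * y) y ≤ 0 := fun h hh =>
    hmax _ (fun hc => hy ((hXa.mul_mem_iff hh y).1 hc)) (hHN h hh y hyN)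
  -- `h` and `h⁻¹` both move `y` weakly down, so neither changes its level.
  have hzero : ∀ h ∈ H, separation (equivalentTranslates H X) (h * y) y = 0 := by
    intro h hh
    have h1 := hle h hh
    have h2 := hle h⁻¹ (inv_mem hh)
    rw [← hsmul h hh, mul_inv_cancel_left] at h2
    have h3 := hadd (h * y) y (h * y)
    rw [hself] at h3
    omega
  have hinv : ∀ h ∈ H, ∀ x, separation (equivalentTranslates H X) (h * x) y =
      separation (equivalentTranslates H X) x y := by
    intro h hh x
    rw [← hadd (h * x) (h * y) y, hsmul h hh, hzero h hh, add_zero]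
  have hYH : ∀ h ∈ H, h • {x | 0 < separation (equivalentTranslates H X) x y} =
      {x | 0 < separation (equivalentTranslates H X) x y} := by
    intro h hh
    ext x
    rw [Set.mem_smul_set_iff_inv_smul_mem]
    simp only [Set.mem_ofPred_eq, smul_eq_mul, hinv _ (inv_mem hh)]
  have hYX : AlmostEqualMod H {x | 0 < separation (equivalentTranslates H X) x y} X := by
    refine hN.mono ?_
    rintro x (⟨hx, hxX⟩ | ⟨hxX, hx⟩) <;> by_contra hxN <;> simp only [Set.mem_ofPred_eq] at hx
    · exact absurd (hmax x hxX hxN) (by omega)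
    · exact hx (hsep x hxX hxN y hy hyN)
  exact ⟨_, isNontrivialAlmostInvariant_iff.2 ⟨hXa.of_almostEqualMod hYH hYX,
    not_isFiniteMod_of_almostEqualMod hYX hX1, not_isFiniteMod_of_almostEqualMod hYX.compl hX2⟩,
    hYX, hXa.translatesNestedWrt y⟩

end AlmostInvariantSets

/-- The set `{g ∈ G : gX ∼ X or gX ∼ X*}` is a subgroup `𝒦` of `G`, and the translates of some
`Y` equivalent to `X` are nested with respect to it. Here `gX` is an `H^g`-almost invariant set. -/
theorem mainTheorem4 {G : Type*} [Group G] [Group.FG G] (H : Subgroup G) (hH : H.FG)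
    (X : Set G) (hX : AlmostInvariantSets.IsNontrivialAlmostInvariant H X) :
    ∃ 𝒦 : Subgroup G,
      (𝒦 : Set G) = {g : G |
        AlmostInvariantSets.Equivalent (AlmostInvariantSets.conj g H) H (g • X) X ∨
        AlmostInvariantSets.Equivalent (AlmostInvariantSets.conj g H) H (g • X) Xᶜ} ∧
      ∃ (H' : Subgroup G) (Y : Set G),
        Subgroup.Commensurable H' H ∧
        AlmostInvariantSets.IsNontrivialAlmostInvariant H' Y ∧
        AlmostInvariantSets.Equivalent H' H Y X ∧
        AlmostInvariantSets.TranslatesNestedWrt 𝒦 Y := by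
  obtain ⟨Y, hY, hYX, hnested⟩ := hX.exists_nested hH
  exact ⟨AlmostInvariantSets.classStabilizer H X, AlmostInvariantSets.coe_classStabilizer hX,
    H, Y, Subgroup.Commensurable.refl H, hY, ⟨hY.1, hX.1, hYX⟩, hnested⟩
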